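/- **Theorem (recurrence of scale-free percolation in two dimensions).** Scale-free percolation (SFP) on $\mathbb{Z}^d$ with parameters $\alpha,\lambda>0$ and weight law $W$ is the following random graph with vertex set $\mathbb{Z}^d$. The vertices carry i.i.d. nonnegative weights $(W_x)_{x\in\mathbb{Z}^d}$ with law $W$; conditionally on the weights, each edge $\{x,y\}$ ($x\ne y$ in $\mathbb{Z}^d$) is open, independently of all other edges, with probability $$p_{xy}=1-\exp\Big(-\lambda\,\frac{W_xW_y}{|x-y|^{\alpha}}\Big),\qquad |x-y|=\|x-y\|_1 .$$ Let $\mathbb{P}_{(\lambda,W)}$ be the joint law of weights and edges, and let $$\lambda_c(d,\alpha,W)=\inf\{\lambda>0 : \text{there exists an infinite cluster } \mathbb{P}_{(\lambda,W)}\text{-a.s.}\}\in[0,\infty],$$ where a cluster is a connected component of the graph of open edges. A graph is called recurrent if it is locally finite and, from every starting vertex $X_0$, the simple random walk on it (which moves at each step to a uniformly chosen neighbour) almost surely returns to $X_0$. Let $d=2$, let $\tau>1$, $c>0$, and suppose that $$\mathbb{P}(W\ge w)\le c\,w^{-(\tau-1)}\qquad\text{for all } w>0 .$$ Let $\alpha>4$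 and $\lambda>\lambda_c(2,\alpha,W)$, and suppose that $\tau>2$ or $\gamma>2$ (or both), where $\gamma=\alpha(\tau-1)/d=\alpha(\tau-1)/2$. Then, $\mathbb{P}_{(\lambda,W)}$-almost surely, there exists an infinite cluster and every infinite cluster is recurrent. -/

import Mathlib

open MeasureTheory ProbabilityTheory
open scoped NNReal ENNReal

namespace SFP

noncomputable section

/-- The vertex set `ℤ^d`. -/
abbrev Zd (d : ℕ) : Type := Fin d → ℤ

/-- The `ℓ¹`-distance `|x - y|` on `ℤ^d`. -/
def dist1 {d : ℕ} (x y : Zd d) : ℝ := ∑ i, |((x i : ℝ) - (y i : ℝ))|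

lemma dist1_comm {d : ℕ} (x y : Zd d) : dist1 x y = dist1 y x := by
  simp only [dist1]
  exact Finset.sum_congr rfl fun i _ => abs_sub_comm _ _

lemma dist1_nonneg {d : ℕ} (x y : Zd d) : 0 ≤ dist1 x y :=
  Finset.sum_nonneg fun _ _ => abs_nonneg _

/-- The probability `1 - exp (-λ W_x W_y / |x - y|^α)` that the edge `{x, y}` is open, given the
weights `w`. -/
def edgeProb {d : ℕ} (α : ℝ) (lam : ℝ≥0) (w : Zd d → ℝ≥0) : Sym2 (Zd d) → unitInterval :=
  Sym2.lift ⟨fun x y =>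
    ⟨1 - Real.exp (-((lam : ℝ) * ((w x : ℝ) * (w y : ℝ) / dist1 x y ^ α))), by
      have h : 0 ≤ (lam : ℝ) * ((w x : ℝ) * (w y : ℝ) / dist1 x y ^ α) :=
        mul_nonneg lam.2 (div_nonneg (mul_nonneg (w x).2 (w y).2)
          (Real.rpow_nonneg (dist1_nonneg x y) α))
      have h1 : Real.exp (-((lam : ℝ) * ((w x : ℝ) * (w y : ℝ) / dist1 x y ^ α))) ≤ 1 :=
        Real.exp_le_one_iff.2 (neg_nonpos.2 h)
      have h2 := Real.exp_pos (-((lam : ℝ) * ((w x : ℝ) * (w y : ℝ) / dist1 x y ^ α)))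
      exact ⟨by linarith, by linarith⟩⟩,
    fun x y => by
      apply Subtype.ext
      simp only [dist1_comm x y, mul_comm (w x : ℝ)]⟩

lemma measurable_edgeProb {d : ℕ} (α : ℝ) (lam : ℝ≥0) (e : Sym2 (Zd d)) :
    Measurable fun w : Zd d → ℝ≥0 => edgeProb α lam w e := by
  induction e with
  | h x y =>
    apply Measurable.subtype_mk
    fun_prop

/-- The law of the edge configuration given the weights `w`: the edges are independent, and the
edge `e` is open (`true`) with probability `edgeProb α lam w e`. -/
def edgeMeasure {d : ℕ} (α : ℝ) (lam : ℝ≥0) (w : Zd d → ℝ≥0) : Measure (Sym2 (Zd d) → Bool) :=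
  Measure.infinitePi fun e => bernoulliMeasure true false (edgeProb α lam w e)

instance {d : ℕ} (α : ℝ) (lam : ℝ≥0) (w : Zd d → ℝ≥0) :
    IsProbabilityMeasure (edgeMeasure α lam w) := by
  unfold edgeMeasure; infer_instance

lemma measurable_edgeMeasure {d : ℕ} (α : ℝ) (lam : ℝ≥0) :
    Measurable (edgeMeasure (d := d) α lam) := by
  classical
  refine Measurable.measure_of_isPiSystem_of_isProbabilityMeasure
    (generateFrom_squareCylinders (α := fun _ : Sym2 (Zd d) => Bool)).symm
    (isPiSystem_squareCylinders (fun _ ↦ MeasurableSpace.isPiSystem_measurableSet) (by simp)) ?_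
  rintro _ ⟨s, t, ht, rfl⟩
  have key : ∀ w : Zd d → ℝ≥0, edgeMeasure α lam w (Set.pi s t) =
      ∏ e ∈ s, bernoulliMeasure true false (edgeProb α lam w e) (t e) := fun w =>
    Measure.infinitePi_pi _ fun e _ => ht e (Set.mem_univ e)
  simp only [key]
  refine Finset.measurable_prod _ fun e _ => ?_
  have hp := measurable_edgeProb α lam e
  have h1 : Measurable fun w => ((unitInterval.toNNReal (edgeProb α lam w e) : ℝ≥0) : ℝ≥0∞) :=
    (unitInterval.toNNReal_continuous.measurable.comp hp).coe_nnreal_ennreal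
  have h2 : Measurable fun w =>
      ((unitInterval.toNNReal (unitInterval.symm (edgeProb α lam w e)) : ℝ≥0) : ℝ≥0∞) :=
    (unitInterval.toNNReal_continuous.measurable.comp
      (unitInterval.continuous_symm.measurable.comp hp)).coe_nnreal_ennreal
  have he : MeasurableSet (t e) := ht e (Set.mem_univ e)
  simp only [bernoulliMeasure_apply _ he]
  split_ifs <;> fun_prop

/-- The conditional law of the edge configuration given the weights, as a Markov kernel. -/
def edgeKernel (d : ℕ) (α : ℝ) (lam : ℝ≥0) : Kernel (Zd d → ℝ≥0) (Sym2 (Zd d) → Bool) :=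
  ⟨edgeMeasure α lam, measurable_edgeMeasure α lam⟩

instance (d : ℕ) (α : ℝ) (lam : ℝ≥0) : IsMarkovKernel (edgeKernel d α lam) :=
  ⟨fun w => inferInstanceAs (IsProbabilityMeasure (edgeMeasure α lam w))⟩

/-- The joint law of weights and edge configuration of scale-free percolation on `ℤ^d`: the weights
are i.i.d. with law `μ`, and given the weights the edges are drawn from `edgeKernel d α lam`. -/
def law (d : ℕ) (α : ℝ) (lam : ℝ≥0) (μ : Measure ℝ≥0) :
    Measure ((Zd d → ℝ≥0) × (Sym2 (Zd d) → Bool)) :=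
  (Measure.infinitePi fun _ : Zd d => μ) ⊗ₘ edgeKernel d α lam

/-- The random graph: the open edges of the configuration. -/
def openGraph {d : ℕ} (ω : (Zd d → ℝ≥0) × (Sym2 (Zd d) → Bool)) : SimpleGraph (Zd d) :=
  SimpleGraph.fromEdgeSet {e | ω.2 e = true}

/-- The graph has an infinite cluster (connected component). -/
def HasInfiniteCluster {V : Type*} (G : SimpleGraph V) : Prop :=
  ∃ C : G.ConnectedComponent, C.supp.Infinite

/-- The critical value `λ_c(d, α, W)`, where `μ` is the law of `W`: the infimum in `[0, ∞]` of the
`λ > 0` for which there almost surely exists an infinite cluster (it is `∞` if there is none). -/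
def lambdaC (d : ℕ) (α : ℝ) (μ : Measure ℝ≥0) : ℝ≥0∞ :=
  sInf {l | ∃ lam : ℝ≥0, l = lam ∧ 0 < lam ∧
    ∀ᵐ ω ∂(law d α lam μ), HasInfiniteCluster (openGraph ω)}

/-- The parameter `γ = α (τ - 1) / d`. -/
def gammaParam (d : ℕ) (α τ : ℝ) : ℝ := α * (τ - 1) / d

section RandomWalk

variable {V : Type*} [MeasurableSpace V] [DiscreteMeasurableSpace V]

open Classical in
/-- One step of simple random walk: a uniformly chosen neighbour of `x`. (By convention the walk
stays put at a vertex that has no neighbour or infinitely many.) -/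
def srwStep (G : SimpleGraph V) (x : V) : Measure V :=
  if (G.neighborSet x).Finite ∧ (G.neighborSet x).Nonempty then uniformOn (G.neighborSet x)
  else Measure.dirac x

instance (G : SimpleGraph V) (x : V) : IsProbabilityMeasure (srwStep G x) := by
  unfold srwStep
  split_ifs with h
  · exact isProbabilityMeasure_uniformOn h.1 h.2
  · infer_instance

/-- The step of simple random walk as a Markov kernel on `V`. -/
def srwKernel (G : SimpleGraph V) : Kernel V V := ⟨srwStep G, .of_discrete⟩

instance (G : SimpleGraph V) : IsMarkovKernel (srwKernel G) :=
  ⟨fun x => inferInstanceAs (IsProbabilityMeasure (srwStep G x))⟩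

/-- The law on trajectories `ℕ → V` of simple random walk on `G` started at `X₀ = x`: given
`X₀, …, Xₙ`, the next position is drawn from `srwStep G (Xₙ)`. -/
def srwLaw (G : SimpleGraph V) (x : V) : Measure (ℕ → V) :=
  Kernel.traj (X := fun _ : ℕ => V)
    (fun n => (srwKernel G).comap (fun h : (Π _ : Finset.Iic n, V) => h ⟨n, by simp⟩)
      (measurable_pi_apply _)) 0 (fun _ => x)

/-- A graph is recurrent if it is locally finite and, from every starting point, simple random walk
almost surely returns to its starting point. -/
def IsRecurrent (G : SimpleGraph V) : Prop :=
  (∀ x, (G.neighborSet x).Finite) ∧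
    ∀ x, ∀ᵐ X ∂(srwLaw G x), ∃ n : ℕ, 0 < n ∧ X n = x

end RandomWalk

end

end SFP

/-! Recurrence is proved by a first-moment bound on Dirichlet energies. Since `1 - exp (-t) ≤ t ^ s`
for `0 < s ≤ 1`, averaging over independent weights bounds the probability that `x` and `y` are
joined by a constant times `|x - y| ^ (-α s)`, as soon as `W` has a finite moment of order `s`
(`law_adj_le`). The tail bound gives such moments for `s < τ - 1`, and the condition `τ > 2` or `γ >
2` leaves room for `4 / α < s < min 1 (τ - 1)`. Then `α s > 4`, so the connection function has a
finite second moment on `ℤ²`.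

With a finite second moment the long edges are harmless: as for the nearest-neighbour lattice, the
expected energy of a logarithmic cutoff at scale `N` is `O(1 / log N)` (`tsum_mul_logCutoff_le`). By
Fatou, almost surely every vertex carries unit potentials of finite support and arbitrarily small
energy (`ae_exists_energy_le`).

Such potentials force recurrence (`ae_return_of_dirichlet_le`). The function "probability of hitting
`x` by time `n`" is almost harmonic off `x`, and both its energy and its pairing with a test
potential are governed by the escape probability, so Cauchy–Schwarz forces that probability to
vanish in the limit. This covers all clusters, infinite or not.

Existence of an infinite cluster above `λ_c` is separate: it follows from a monotone coupling of the
edges given the weights (`ae_hasInfiniteCluster`). -/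

namespace SFP

open Filter Topology

/-! ### Dirichlet forms and escape rates on a locally finite graph. -/

section Energy

variable {V : Type*}

open Classical in
/-- The bilinear Dirichlet form of `G` restricted to ordered pairs in the finite set `S`. -/
noncomputable def dirichlet (G : SimpleGraph V) (S : Finset V) (f g : V → ℝ) : ℝ :=
  ∑ u ∈ S, ∑ v ∈ S, if G.Adj u v then (f u - f v) * (g u - g v) else 0

/-- Summation by parts. As `S` contains the support of `f` and all neighbours of that support,
restricting to `S` loses no edge on which `f` contributes, and `g` may be arbitrary. The factor 2
comes from counting ordered pairs. -/
lemma dirichlet_eq (G : SimpleGraph V) (S : Finset V) (f g : V → ℝ)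
    (hG : ∀ v, (G.neighborSet v).Finite)
    (hS : ∀ u, f u ≠ 0 → u ∈ S ∧ (hG u).toFinset ⊆ S) :
    dirichlet G S f g = 2 * ∑ u ∈ S, f u * ∑ v ∈ (hG u).toFinset, (g u - g v) := by
  classical
  have hsplit : dirichlet G S f g =
      (∑ u ∈ S, ∑ v ∈ S, if G.Adj u v then f u * (g u - g v) else 0) +
      ∑ u ∈ S, ∑ v ∈ S, if G.Adj u v then f v * (g v - g u) else 0 := by
    rw [dirichlet, ← Finset.sum_add_distrib]
    refine Finset.sum_congr rfl fun u _ => ?_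
    rw [← Finset.sum_add_distrib]
    refine Finset.sum_congr rfl fun v _ => ?_
    split_ifs <;> ring
  have hswap : (∑ u ∈ S, ∑ v ∈ S, if G.Adj u v then f v * (g v - g u) else 0) =
      ∑ u ∈ S, ∑ v ∈ S, if G.Adj u v then f u * (g u - g v) else 0 := by
    rw [Finset.sum_comm]
    simp only [G.adj_comm]
  rw [hsplit, hswap, ← two_mul]
  congr 1
  refine Finset.sum_congr rfl fun u _ => ?_
  by_cases hu : f u = 0
  · simp [hu]
  have hsub := (hS u hu).2
  rw [Finset.mul_sum, ← Finset.sum_filter]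
  refine Finset.sum_congr ?_ fun _ _ => rfl
  ext v
  simp only [Finset.mem_filter, Set.Finite.mem_toFinset, SimpleGraph.mem_neighborSet,
    and_iff_right_iff_imp]
  exact fun h => hsub (by simpa using h)

lemma dirichlet_sq_le (G : SimpleGraph V) (S : Finset V) (f g : V → ℝ) :
    dirichlet G S f g ^ 2 ≤ dirichlet G S f f * dirichlet G S g g := by
  classical
  have key (f g : V → ℝ) : dirichlet G S f g = ∑ p ∈ S ×ˢ S,
      (if G.Adj p.1 p.2 then f p.1 - f p.2 else 0) *
        (if G.Adj p.1 p.2 then g p.1 - g p.2 else 0) := by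
    rw [dirichlet, Finset.sum_product]
    refine Finset.sum_congr rfl fun u _ => Finset.sum_congr rfl fun v _ => ?_
    split_ifs <;> simp
  rw [key, key, key]
  simpa only [sq] using Finset.sum_mul_sq_le_sq_mul_sq (S ×ˢ S)
    (fun p => if G.Adj p.1 p.2 then f p.1 - f p.2 else 0)
    (fun p => if G.Adj p.1 p.2 then g p.1 - g p.2 else 0)

/-- If unit potentials at `x` of finite support and arbitrarily small energy exist, then the escape
rates `e n` from `x` of the approximate harmonic functions `a n` tend to zero. -/
lemma tendsto_zero_of_dirichlet_le (G : SimpleGraph V) (hG : ∀ v, (G.neighborSet v).Finite) (x : V)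
    (hN : (G.neighborSet x).Nonempty)
    (hE : ∀ ε : ℝ, 0 < ε → ∃ f : V → ℝ, f.support.Finite ∧ f x = 1 ∧
      ∀ S : Finset V, dirichlet G S f f ≤ ε)
    (a : ℕ → V → ℝ) (e : ℕ → ℝ) (ha0 : ∀ n v, 0 ≤ a n v) (ha1 : ∀ n v, a n v ≤ 1)
    (hax : ∀ n, a n x = 0) (hanti : ∀ v, Antitone fun n => a n v)
    (hsupp : ∀ n, {v | a n v ≠ 1}.Finite)
    (hharm : ∀ n v, v ≠ x → ∑ u ∈ (hG v).toFinset, (a n v - a n u) =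
      (hG v).toFinset.card * (a n v - a (n + 1) v))
    (he : ∀ n, ∑ u ∈ (hG x).toFinset, a n u = (hG x).toFinset.card * e n) :
    Tendsto e atTop (𝓝 0) := by
  classical
  set D : ℝ := ((hG x).toFinset.card : ℝ) with hD
  have hDpos : 0 < D := by
    rw [hD, Nat.cast_pos, Finset.card_pos]
    simpa using hN
  have he' (n : ℕ) : e n = (∑ u ∈ (hG x).toFinset, a n u) / D := by
    rw [he, mul_div_cancel_left₀ _ hDpos.ne']
  have he0 (n : ℕ) : 0 ≤ e n := by
    rw [he']
    exact div_nonneg (Finset.sum_nonneg fun u _ => ha0 n u) hDpos.le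
  have hconv (v : V) : Tendsto (fun n => a n v) atTop (𝓝 (⨅ n, a n v)) :=
    tendsto_atTop_ciInf (hanti v) ⟨0, by rintro _ ⟨n, rfl⟩; exact ha0 n v⟩
  obtain ⟨l, hl⟩ : ∃ l, Tendsto e atTop (𝓝 l) := by
    refine ⟨(∑ u ∈ (hG x).toFinset, ⨅ n, a n u) / D, ?_⟩
    rw [funext he']
    exact (tendsto_finsetSum _ fun u _ => hconv u).div_const _
  have hl0 : 0 ≤ l := ge_of_tendsto' hl he0
  -- Test `h = 1 - a n` against a potential `f` of energy at most `ε`. By Green's formula the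
  -- pairing is `2 (D e n - R n)`, where `R n` collects the defects of harmonicity on the support of
  -- `f` and tends to 0, while the energy of `h` is at most `2 D e n`. Cauchy–Schwarz in the limit
  -- reads `(2 D l) ^ 2 ≤ ε (2 D l)`.
  have hmain : ∀ ε : ℝ, 0 < ε → 2 * (D * l) ≤ ε := by
    intro ε hε
    obtain ⟨f, hfs, hfx, hfE⟩ := hE ε hε
    let R : ℕ → ℝ := fun n => ∑ u ∈ hfs.toFinset.erase x,
      f u * ((hG u).toFinset.card * (a n u - a (n + 1) u))
    have hR : Tendsto R atTop (𝓝 0) := by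
      have : Tendsto R atTop (𝓝 (∑ u ∈ hfs.toFinset.erase x,
          f u * ((hG u).toFinset.card * ((⨅ n, a n u) - ⨅ n, a n u)))) :=
        tendsto_finsetSum _ fun u _ => (((hconv u).sub
          ((hconv u).comp (tendsto_add_atTop_nat 1))).const_mul _).const_mul _
      simpa using this
    have hineq (n : ℕ) : (2 * (D * e n - R n)) ^ 2 ≤ ε * (2 * (D * e n)) := by
      let h : V → ℝ := fun v => 1 - a n v
      have hlap (v : V) (hv : v ≠ x) : ∑ u ∈ (hG v).toFinset, (h v - h u) =
          -((hG v).toFinset.card * (a n v - a (n + 1) v)) := by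
        rw [← hharm n v hv, ← Finset.sum_neg_distrib]
        exact Finset.sum_congr rfl fun u _ => by simp only [h]; ring
      have hlapx : ∑ u ∈ (hG x).toFinset, (h x - h u) = D * e n := by
        rw [← he n]
        exact Finset.sum_congr rfl fun u _ => by simp [h, hax]
      let S₀ : Finset V := insert x (hfs.toFinset ∪ (hsupp n).toFinset)
      let S : Finset V := S₀ ∪ S₀.biUnion fun u => (hG u).toFinset
      have hS₀ (u : V) (hu : u ∈ S₀) : u ∈ S ∧ (hG u).toFinset ⊆ S :=
        ⟨Finset.mem_union_left _ hu, (Finset.subset_biUnion_of_mem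
          (fun u => (hG u).toFinset) hu).trans Finset.subset_union_right⟩
      have hxS : x ∈ S := (hS₀ x (Finset.mem_insert_self _ _)).1
      have hfS (u : V) (hu : f u ≠ 0) : u ∈ S ∧ (hG u).toFinset ⊆ S :=
        hS₀ u (by simp [S₀, hu])
      have hhS (u : V) (hu : h u ≠ 0) : u ∈ S ∧ (hG u).toFinset ⊆ S :=
        hS₀ u (by simp only [S₀, Finset.mem_insert, Finset.mem_union, Set.Finite.mem_toFinset,
          Set.mem_ofPred_eq]; exact Or.inr (Or.inr fun h1 => hu (by simp [h, h1])))
      have hfh : dirichlet G S f h = 2 * (D * e n - R n) := by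
        rw [dirichlet_eq G S f h hG hfS, ← Finset.add_sum_erase _ _ hxS, hlapx, hfx, one_mul,
          sub_eq_add_neg]
        congr 2
        rw [← Finset.sum_neg_distrib]
        symm
        refine (Finset.sum_subset_zero_on_sdiff (Finset.erase_subset_erase _ ?_) ?_ ?_)
        · intro u hu
          exact (hfS u (by simpa using hu)).1
        · intro u hu
          have : f u = 0 := by
            by_contra h0
            simp only [Finset.mem_sdiff, Finset.mem_erase, Set.Finite.mem_toFinset,
              Function.mem_support] at hu
            exact hu.2 ⟨hu.1.1, h0⟩
          simp [this]
        · intro u hu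
          rw [hlap u (Finset.ne_of_mem_erase hu)]
          ring
      have hhh : dirichlet G S h h ≤ 2 * (D * e n) := by
        rw [dirichlet_eq G S h h hG hhS, ← Finset.add_sum_erase _ _ hxS, hlapx]
        -- Monotonicity in `n` gives the Laplacian of `h` a sign off `x`, and `h ≥ 0`; only the term
        -- at `x` is left as an upper bound.
        have : ∑ u ∈ S.erase x, h u * ∑ v ∈ (hG u).toFinset, (h u - h v) ≤ 0 := by
          refine Finset.sum_nonpos fun u hu => ?_
          rw [hlap u (Finset.ne_of_mem_erase hu)]
          have h1 : 0 ≤ h u := sub_nonneg.2 (ha1 n u)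
          have h2 : 0 ≤ a n u - a (n + 1) u := sub_nonneg.2 (hanti u n.le_succ)
          have h3 := mul_nonneg h1 (mul_nonneg (Nat.cast_nonneg (hG u).toFinset.card) h2)
          linarith
        have hx1 : h x = 1 := by simp [h, hax]
        rw [hx1]
        linarith
      calc (2 * (D * e n - R n)) ^ 2 = dirichlet G S f h ^ 2 := by rw [hfh]
        _ ≤ dirichlet G S f f * dirichlet G S h h := dirichlet_sq_le _ _ _ _
        _ ≤ ε * (2 * (D * e n)) := by
          have h0 : 0 ≤ dirichlet G S h h :=
            Finset.sum_nonneg fun u _ => Finset.sum_nonneg fun v _ => by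
              split_ifs
              · exact mul_self_nonneg _
              · exact le_rfl
          exact mul_le_mul (hfE S) hhh h0 hε.le
    have hlim := le_of_tendsto_of_tendsto' ((((hl.const_mul D).sub hR).const_mul 2).pow 2)
      (((hl.const_mul D).const_mul 2).const_mul ε) hineq
    rw [sub_zero] at hlim
    rcases hl0.eq_or_lt with h0 | h0
    · rw [← h0]; simpa using hε.le
    · have : 0 < 2 * (D * l) := mul_pos two_pos (mul_pos hDpos h0)
      nlinarith
  have : l = 0 := by
    by_contra h0
    have hlpos : 0 < l := lt_of_le_of_ne hl0 (Ne.symm h0)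
    -- The choice `ε = D l` gives `2 D l ≤ D l`, impossible for `l > 0`.
    have := hmain (D * l) (mul_pos hDpos hlpos)
    nlinarith [mul_pos hDpos hlpos]
  rwa [this] at hl

end Energy

/-! ### From escape rates to return of the simple random walk. -/

section RandomWalk

set_option linter.unusedSectionVars false

variable {V : Type*} [MeasurableSpace V] [DiscreteMeasurableSpace V]

/-- The Markov property at time `k`, read off from the description of the law up to time `k + 1` as
the law up to time `k` followed by one step of the kernel. -/
lemma srwLaw_step (G : SimpleGraph V) (x : V) (k : ℕ)
    {F : (Finset.Iic k → V) → ℝ≥0∞} (hF : Measurable F) (g : V → ℝ≥0∞) :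
    ∫⁻ X, F (Preorder.frestrictLe k X) * g (X (k + 1)) ∂(srwLaw G x) =
      ∫⁻ X, F (Preorder.frestrictLe k X) * ∫⁻ u, g u ∂(srwStep G (X k)) ∂(srwLaw G x) := by
  have hg : Measurable g := .of_discrete
  set κ : (n : ℕ) → Kernel (Π _ : Finset.Iic n, V) V := fun n =>
    (srwKernel G).comap (fun h : (Π _ : Finset.Iic n, V) => h ⟨n, by simp⟩)
      (measurable_pi_apply _) with hκ
  have hlaw : srwLaw G x = Kernel.traj (X := fun _ : ℕ => V) κ 0 (fun _ => x) := rfl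
  have hm : Measurable fun p : (Finset.Iic k → V) × V => F p.1 * g p.2 :=
    (hF.comp measurable_fst).mul (hg.comp measurable_snd)
  have hm' : Measurable fun z : Finset.Iic k → V =>
      F z * ∫⁻ u, g u ∂(srwStep G (z ⟨k, by simp⟩)) :=
    hF.mul ((Measurable.of_discrete (f := fun v : V => ∫⁻ u, g u ∂(srwStep G v))).comp
      (measurable_pi_apply _))
  have h1 := Kernel.partialTraj_compProd_eq_map_traj (X := fun _ : ℕ => V) (κ := κ)
    (Nat.zero_le k) (x₀ := fun _ => x)
  calc ∫⁻ X, F (Preorder.frestrictLe k X) * g (X (k + 1)) ∂(srwLaw G x)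
      = ∫⁻ p, F p.1 * g p.2 ∂((srwLaw G x).map
          (fun X => (Preorder.frestrictLe (π := fun _ : ℕ => V) k X, X (k + 1)))) := by
        rw [lintegral_map hm (by fun_prop)]
    _ = ∫⁻ z, F z * ∫⁻ u, g u ∂(srwStep G (z ⟨k, by simp⟩))
          ∂(Kernel.partialTraj (X := fun _ : ℕ => V) κ 0 k fun _ => x) := by
        rw [hlaw, ← h1, Measure.lintegral_compProd hm]
        refine lintegral_congr fun z => ?_
        change ∫⁻ u, F z * g u ∂(srwStep G (z ⟨k, by simp⟩)) = _
        exact lintegral_const_mul _ hg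
    _ = _ := by
        rw [← Kernel.traj_map_frestrictLe, Kernel.map_apply _ (by fun_prop), ← hlaw,
          lintegral_map hm' (by fun_prop)]
        rfl

lemma srwLaw_start (G : SimpleGraph V) (x : V) {g : V → ℝ≥0∞} :
    ∫⁻ X, g (X 0) ∂(srwLaw G x) = g x := by
  have hg : Measurable g := .of_discrete
  have hm : Measurable fun z : Finset.Iic 0 → V => g (z ⟨0, by simp⟩) :=
    hg.comp (measurable_pi_apply _)
  have : ∫⁻ X, g (X 0) ∂(srwLaw G x) = ∫⁻ z, g (z ⟨0, by simp⟩)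
      ∂((srwLaw G x).map (Preorder.frestrictLe (π := fun _ : ℕ => V) 0)) := by
    rw [lintegral_map hm (by fun_prop)]
    rfl
  rw [this, srwLaw, ← Kernel.map_apply _ (by fun_prop), Kernel.traj_map_frestrictLe,
    Kernel.partialTraj_self, Kernel.id_apply, lintegral_dirac' _ hm]

open Classical in
/-- The probability that the walk started at `v` does not visit `x` at any of the times
`0, …, n`. -/
noncomputable def avoidProb (G : SimpleGraph V) (x : V) : ℕ → V → ℝ≥0∞
  | 0, v => if v = x then 0 else 1
  | n + 1, v => if v = x then 0 else ∫⁻ u, avoidProb G x n u ∂(srwStep G v)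

lemma avoidProb_self (G : SimpleGraph V) (x : V) (n : ℕ) : avoidProb G x n x = 0 := by
  cases n <;> simp [avoidProb]

lemma avoidProb_zero_of_ne (G : SimpleGraph V) {x v : V} (hv : v ≠ x) : avoidProb G x 0 v = 1 := by
  simp [avoidProb, hv]

lemma avoidProb_succ_of_ne (G : SimpleGraph V) {x v : V} (hv : v ≠ x) (n : ℕ) :
    avoidProb G x (n + 1) v = ∫⁻ u, avoidProb G x n u ∂(srwStep G v) := by
  simp [avoidProb, hv]

lemma avoidProb_le_one (G : SimpleGraph V) (x : V) (n : ℕ) (v : V) : avoidProb G x n v ≤ 1 := by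
  induction n generalizing v with
  | zero => unfold avoidProb; split_ifs <;> simp
  | succ n ih =>
    unfold avoidProb
    split_ifs
    · simp
    · exact (lintegral_mono ih).trans (by simp)

lemma avoidProb_antitone (G : SimpleGraph V) (x : V) : Antitone (avoidProb G x) := by
  refine antitone_nat_of_succ_le fun n => ?_
  induction n with
  | zero =>
    intro v
    by_cases hv : v = x
    · simp [hv, avoidProb_self]
    · rw [avoidProb_zero_of_ne G hv]; exact avoidProb_le_one G x _ v
  | succ n ih =>
    intro v
    by_cases hv : v = x
    · simp [hv, avoidProb_self]
    · rw [avoidProb_succ_of_ne G hv, avoidProb_succ_of_ne G hv]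
      exact lintegral_mono ih

/-- The event that the trajectory does not visit `x` at the times `1, …, n`. -/
def avoidSet (x : V) (n : ℕ) : Set (ℕ → V) := {X | ∀ k, 0 < k → k ≤ n → X k ≠ x}

lemma measurableSet_avoidSet (x : V) (n : ℕ) : MeasurableSet (avoidSet x n) := by
  simp only [avoidSet, Set.ofPred_forall]
  refine .iInter fun k => .iInter fun _ => .iInter fun _ => ?_
  exact (measurableSet_singleton x).compl.preimage (measurable_pi_apply k)

/-- Induction on `m`, trading one step of the recursion for `avoidProb` against one more time in the
event. Using time `k + 1` rather than `k` matters: the event then already forces the current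
position off `x`, where the recursion averages over a step. -/
lemma lintegral_avoidSet (G : SimpleGraph V) (x y : V) (m k : ℕ) :
    ∫⁻ X, (avoidSet x (k + 1)).indicator 1 X * avoidProb G x m (X (k + 1)) ∂(srwLaw G y) =
      srwLaw G y (avoidSet x (k + 1 + m)) := by
  classical
  induction m generalizing k with
  | zero =>
    rw [add_zero, ← lintegral_indicator_one (measurableSet_avoidSet x _)]
    refine lintegral_congr fun X => ?_
    by_cases hX : X ∈ avoidSet x (k + 1)
    · rw [avoidProb_zero_of_ne G (hX (k + 1) k.succ_pos le_rfl), mul_one]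
    · simp [hX]
  | succ m ih =>
    have h2 (X : ℕ → V) : (avoidSet x (k + 1)).indicator 1 X * avoidProb G x (m + 1) (X (k + 1)) =
        (avoidSet x (k + 1)).indicator 1 X * ∫⁻ u, avoidProb G x m u ∂(srwStep G (X (k + 1))) := by
      by_cases hX : X ∈ avoidSet x (k + 1)
      · rw [avoidProb_succ_of_ne G (hX (k + 1) k.succ_pos le_rfl)]
      · simp [hX]
    let T : Set (Finset.Iic (k + 1) → V) := {z | ∀ j : Finset.Iic (k + 1), 0 < j.1 → z j ≠ x}
    have hT : MeasurableSet T := by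
      simp only [T, Set.ofPred_forall]
      refine .iInter fun j => .iInter fun _ => ?_
      exact (measurableSet_singleton x).compl.preimage (measurable_pi_apply j)
    have hTS (X : ℕ → V) : (avoidSet x (k + 1)).indicator (1 : (ℕ → V) → ℝ≥0∞) X =
        T.indicator 1 (Preorder.frestrictLe (π := fun _ : ℕ => V) (k + 1) X) := by
      have : X ∈ avoidSet x (k + 1) ↔
          Preorder.frestrictLe (π := fun _ : ℕ => V) (k + 1) X ∈ T := by
        simp only [avoidSet, T, Set.mem_ofPred_eq, Subtype.forall, Finset.mem_Iic,
          Preorder.frestrictLe_apply]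
        exact ⟨fun h j hj h0 => h j h0 hj, fun h j h0 hj => h j hj h0⟩
      simp only [Set.indicator_apply, this, Pi.one_apply]
    have h3 := srwLaw_step G y (k + 1) (F := T.indicator 1)
      (measurable_const.indicator hT) (avoidProb G x m)
    simp only [← hTS] at h3
    rw [lintegral_congr h2, ← h3, show k + 1 + (m + 1) = k + 1 + 1 + m by ring, ← ih (k + 1)]
    refine lintegral_congr fun X => ?_
    -- The two events differ only in whether time `k + 2` is constrained, and `avoidProb` vanishes
    -- at `x`.
    by_cases hX : X (k + 1 + 1) = x
    · simp [hX, avoidProb_self]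
    · congr 1
      simp only [Set.indicator_apply]
      congr 1
      simp only [avoidSet, Set.mem_ofPred_eq, eq_iff_iff]
      refine ⟨fun h j h0 hj => ?_, fun h j h0 hj => h j h0 (by omega)⟩
      rcases Nat.of_le_succ hj with hj | rfl
      · exact h j h0 hj
      · exact hX

lemma srwLaw_avoidSet (G : SimpleGraph V) (x : V) (m : ℕ) :
    srwLaw G x (avoidSet x (1 + m)) = ∫⁻ u, avoidProb G x m u ∂(srwStep G x) := by
  have h := lintegral_avoidSet G x x m 0
  rw [zero_add] at h
  rw [← h]
  have h2 (X : ℕ → V) : (avoidSet x 1).indicator 1 X * avoidProb G x m (X 1) =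
      avoidProb G x m (X 1) := by
    by_cases hX : X 1 = x
    · simp [hX, avoidProb_self]
    · have : X ∈ avoidSet x 1 := fun k h0 hk => by
        obtain rfl : k = 1 := by omega
        exact hX
      simp [this]
  rw [lintegral_congr h2]
  have h3 := srwLaw_step G x 0 (F := fun _ => 1) measurable_const (avoidProb G x m)
  simp only [one_mul, zero_add] at h3
  rw [h3, srwLaw_start G x (g := fun v => ∫⁻ u, avoidProb G x m u ∂(srwStep G v))]

lemma ae_return_of_tendsto (G : SimpleGraph V) (x : V)
    (h : Tendsto (fun m => ∫⁻ u, avoidProb G x m u ∂(srwStep G x)) atTop (𝓝 0)) :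
    ∀ᵐ X ∂(srwLaw G x), ∃ n : ℕ, 0 < n ∧ X n = x := by
  rw [ae_iff]
  refine le_antisymm (ge_of_tendsto' h fun m => ?_) bot_le
  rw [← srwLaw_avoidSet]
  exact measure_mono fun X hX k h0 _ hk => hX ⟨k, h0, hk⟩

/-- Turns the averaging recursion for `avoidProb` into the degree-weighted Laplacian identity that
the energy argument needs. -/
lemma card_mul_lintegral_srwStep (G : SimpleGraph V) (v : V) (hv : (G.neighborSet v).Finite)
    (hne : (G.neighborSet v).Nonempty) {g : V → ℝ≥0∞} (hg : ∀ u, g u ≤ 1) :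
    ∑ u ∈ hv.toFinset, (g u).toReal =
      hv.toFinset.card * (∫⁻ u, g u ∂(srwStep G v)).toReal := by
  have hcard : (hv.toFinset.card : ℝ≥0∞) ≠ 0 := by
    rw [Nat.cast_ne_zero]
    exact Finset.card_ne_zero.2 (by simpa using hne)
  have hint : ∫⁻ u, g u ∂(srwStep G v) = (hv.toFinset.card : ℝ≥0∞)⁻¹ * ∑ u ∈ hv.toFinset, g u := by
    rw [srwStep, if_pos ⟨hv, hne⟩, uniformOn, ProbabilityTheory.cond, lintegral_smul_measure]
    nth_rw 1 2 [← hv.coe_toFinset]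
    rw [lintegral_finset, Measure.count_apply_finset]
    simp
  rw [hint, ENNReal.toReal_mul, ENNReal.toReal_inv, ENNReal.toReal_natCast,
    ENNReal.toReal_sum fun u _ => ((hg u).trans_lt ENNReal.one_lt_top).ne, ← mul_assoc,
    mul_inv_cancel₀ (by exact_mod_cast hcard), one_mul]

/-- In `n` steps the walk can hit `x` only from the ball of radius `n`, which is finite by local
finiteness. Hence `1 - avoidProb` is a legitimate argument of Green's formula. -/
lemma avoidProb_support_finite (G : SimpleGraph V) (hG : ∀ v, (G.neighborSet v).Finite) (x : V)
    (n : ℕ) : {v | avoidProb G x n v ≠ 1}.Finite := by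
  induction n with
  | zero =>
    refine (Set.finite_singleton x).subset fun v hv => ?_
    by_contra hvx
    exact hv (avoidProb_zero_of_ne G hvx)
  | succ n ih =>
    refine ((Set.finite_singleton x).union
      (ih.union (ih.biUnion fun u _ => hG u))).subset fun v hv => ?_
    by_contra hmem
    simp only [Set.mem_union, Set.mem_singleton_iff, Set.mem_ofPred_eq, Set.mem_iUnion, not_or,
      not_exists, not_not, SimpleGraph.mem_neighborSet] at hmem
    obtain ⟨hvx, hvn, hnb⟩ := hmem
    refine hv ?_
    rw [avoidProb_succ_of_ne G hvx]
    have hone : ∀ᵐ u ∂(srwStep G v), avoidProb G x n u = 1 := by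
      unfold srwStep
      split_ifs with h
      · filter_upwards [ae_cond_mem (μ := Measure.count) h.1.measurableSet] with u hu
        by_contra h1
        exact hnb u h1 (SimpleGraph.Adj.symm hu)
      · rw [ae_dirac_eq]
        exact hvn
    rw [lintegral_congr_ae hone]
    simp

/-- Simple random walk on a locally finite graph returns to `x` if there are unit potentials at `x`
of finite support and arbitrarily small Dirichlet energy. -/
theorem ae_return_of_dirichlet_le (G : SimpleGraph V) (hG : ∀ v, (G.neighborSet v).Finite) (x : V)
    (hE : ∀ ε : ℝ, 0 < ε → ∃ f : V → ℝ, f.support.Finite ∧ f x = 1 ∧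
      ∀ S : Finset V, dirichlet G S f f ≤ ε) :
    ∀ᵐ X ∂(srwLaw G x), ∃ n : ℕ, 0 < n ∧ X n = x := by
  have hfin (g : V → ℝ≥0∞) (hg : ∀ u, g u ≤ 1) (v : V) : ∫⁻ u, g u ∂(srwStep G v) ≠ ∞ :=
    ((lintegral_mono hg).trans_lt (by simp)).ne
  have hfin1 (n : ℕ) (v : V) : avoidProb G x n v ≠ ∞ :=
    ((avoidProb_le_one G x n v).trans_lt ENNReal.one_lt_top).ne
  refine ae_return_of_tendsto G x ?_
  by_cases hN : (G.neighborSet x).Nonempty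
  · rw [← ENNReal.tendsto_toReal_iff (fun n => hfin _ (avoidProb_le_one G x n) x) (by simp)]
    refine tendsto_zero_of_dirichlet_le G hG x hN hE (fun n v => (avoidProb G x n v).toReal) _
      (fun n v => ENNReal.toReal_nonneg)
      (fun n v => ENNReal.toReal_le_of_le_ofReal zero_le_one (by simpa using avoidProb_le_one G x n v))
      (fun n => by simp [avoidProb_self])
      (fun v m n hmn => ENNReal.toReal_mono (hfin1 _ _) (avoidProb_antitone G x hmn v))
      (fun n => (avoidProb_support_finite G hG x n).subset fun v hv h1 => hv (by simp [h1]))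
      (fun n v hv => ?_)
      (fun n => card_mul_lintegral_srwStep G x (hG x) hN (avoidProb_le_one G x n))
    by_cases hNv : (G.neighborSet v).Nonempty
    · rw [avoidProb_succ_of_ne G hv, mul_sub, Finset.sum_sub_distrib, Finset.sum_const,
        nsmul_eq_mul, card_mul_lintegral_srwStep G v (hG v) hNv (avoidProb_le_one G x n)]
    · rw [Set.not_nonempty_iff_eq_empty] at hNv
      have : (hG v).toFinset = ∅ := by simpa using hNv
      simp [this]
  -- At an isolated vertex the walk stays put and so returns at time 1.
  · have : srwStep G x = Measure.dirac x := if_neg fun h => hN h.2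
    simp [this, avoidProb_self]

end RandomWalk

/-! ### Monotone coupling in `λ` and existence of an infinite cluster. -/

section Coupling

lemma measurable_decide_le (p : unitInterval) :
    Measurable fun u : unitInterval => decide (u ≤ p) := by
  refine measurable_to_bool ?_
  have : (fun u : unitInterval => decide (u ≤ p)) ⁻¹' {true} = Set.Iic p := by
    ext u; simp
  rw [this]
  exact measurableSet_Iic

lemma map_volume_le_eq_bernoulliMeasure (p : unitInterval) :
    (volume : Measure unitInterval).map (fun u => decide (u ≤ p)) =
      bernoulliMeasure true false p := by
  have hm := measurable_decide_le p
  have htrue : (volume : Measure unitInterval).map (fun u => decide (u ≤ p)) {true} =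
      bernoulliMeasure true false p {true} := by
    rw [Measure.map_apply hm (measurableSet_singleton _),
      bernoulliMeasure_apply _ (measurableSet_singleton _)]
    have : (fun u : unitInterval => decide (u ≤ p)) ⁻¹' {true} = Set.Iic p := by
      ext u; simp
    rw [this, unitInterval.volume_Iic]
    simp [unitInterval.toNNReal, ENNReal.ofReal, Real.toNNReal_of_nonneg p.2.1]
    rfl
  have := Measure.isProbabilityMeasure_map (μ := (volume : Measure unitInterval)) hm.aemeasurable
  refine Measure.ext_of_singleton fun b => ?_
  cases b with
  | true => exact htrue
  | false =>
    have hc : ({false} : Set Bool) = {true}ᶜ := by ext b; simp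
    rw [hc, prob_compl_eq_one_sub (measurableSet_singleton _),
      prob_compl_eq_one_sub (measurableSet_singleton _), htrue]

/-- The standard coupling: one family of independent uniform variables, thresholded at `p i`,
realises all Bernoulli product measures at once and monotonically in `p`. -/
lemma infinitePi_bernoulliMeasure_eq_map {ι : Type*} (p : ι → unitInterval) :
    Measure.infinitePi (fun i => bernoulliMeasure true false (p i)) =
      (Measure.infinitePi fun _ : ι => (volume : Measure unitInterval)).map
        fun U i => decide (U i ≤ p i) := by
  rw [Measure.infinitePi_map_pi (fun _ : ι => (volume : Measure unitInterval))
    (f := fun i u => decide (u ≤ p i)) fun i => measurable_decide_le (p i)]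
  simp only [map_volume_le_eq_bernoulliMeasure]

/-- Almost sure increasing events stay almost sure when the edge probabilities increase. -/
lemma ae_infinitePi_bernoulliMeasure_mono {ι : Type*} {p q : ι → unitInterval}
    (hpq : ∀ i, p i ≤ q i) {S : Set (ι → Bool)} (hS : MeasurableSet S)
    (hmono : ∀ η ξ : ι → Bool, (∀ i, η i = true → ξ i = true) → η ∈ S → ξ ∈ S)
    (h : ∀ᵐ η ∂(Measure.infinitePi fun i => bernoulliMeasure true false (p i)), η ∈ S) :
    ∀ᵐ η ∂(Measure.infinitePi fun i => bernoulliMeasure true false (q i)), η ∈ S := by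
  have hm (p : ι → unitInterval) : Measurable fun (U : ι → unitInterval) i => decide (U i ≤ p i) :=
    measurable_pi_lambda _ fun i =>
      (measurable_decide_le (p i)).comp (measurable_pi_apply i)
  rw [infinitePi_bernoulliMeasure_eq_map] at h ⊢
  refine (ae_map_iff (hm q).aemeasurable hS).2 ?_
  filter_upwards [ae_of_ae_map (hm p).aemeasurable h] with U hU
  refine hmono _ _ (fun i hi => ?_) hU
  simp only [decide_eq_true_eq] at hi ⊢
  exact hi.trans (hpq i)

lemma edgeProb_mono {d : ℕ} (α : ℝ) {lam lam' : ℝ≥0} (h : lam ≤ lam') (w : Zd d → ℝ≥0)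
    (e : Sym2 (Zd d)) : edgeProb α lam w e ≤ edgeProb α lam' w e := by
  induction e with
  | h x y =>
    rw [← Subtype.coe_le_coe]
    have hnn : 0 ≤ (w x : ℝ) * (w y : ℝ) / dist1 x y ^ α :=
      div_nonneg (mul_nonneg (w x).2 (w y).2) (Real.rpow_nonneg (dist1_nonneg x y) α)
    have := mul_le_mul_of_nonneg_right (NNReal.coe_le_coe.2 h) hnn
    exact sub_le_sub_left (Real.exp_le_exp.2 (neg_le_neg this)) 1

lemma openGraph_adj {d : ℕ} (ω : (Zd d → ℝ≥0) × (Sym2 (Zd d) → Bool)) (x y : Zd d) :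
    (openGraph ω).Adj x y ↔ ω.2 s(x, y) = true ∧ x ≠ y := by
  simp [openGraph]

lemma measurableSet_adj {d : ℕ} (x y : Zd d) :
    MeasurableSet {ω : (Zd d → ℝ≥0) × (Sym2 (Zd d) → Bool) | (openGraph ω).Adj x y} := by
  simp only [openGraph_adj]
  refine MeasurableSet.inter ?_ (.const _)
  exact (measurableSet_singleton true).preimage
    ((measurable_pi_apply s(x, y)).comp measurable_snd)

lemma exists_walk_length_succ {V : Type*} (G : SimpleGraph V) (x y : V) (n : ℕ) :
    (∃ p : G.Walk x y, p.length = n + 1) ↔ ∃ z, G.Adj x z ∧ ∃ p : G.Walk z y, p.length = n := by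
  constructor
  · rintro ⟨p, hp⟩
    cases p with
    | nil => simp at hp
    | cons h q => exact ⟨_, h, q, by simpa using hp⟩
  · rintro ⟨z, h, p, hp⟩
    exact ⟨.cons h p, by simp [hp]⟩

lemma measurableSet_reachable {d : ℕ} (x y : Zd d) :
    MeasurableSet {ω : (Zd d → ℝ≥0) × (Sym2 (Zd d) → Bool) | (openGraph ω).Reachable x y} := by
  have hwalk (n : ℕ) : ∀ x, MeasurableSet {ω : (Zd d → ℝ≥0) × (Sym2 (Zd d) → Bool) |
      ∃ p : (openGraph ω).Walk x y, p.length = n} := by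
    induction n with
    | zero =>
      intro x
      have (ω : (Zd d → ℝ≥0) × (Sym2 (Zd d) → Bool)) :
          (∃ p : (openGraph ω).Walk x y, p.length = 0) ↔ x = y :=
        SimpleGraph.Walk.exists_length_eq_zero_iff
      simp only [this]
      exact .const _
    | succ n ih =>
      intro x
      simp only [exists_walk_length_succ, Set.ofPred_exists]
      exact .iUnion fun z => (measurableSet_adj x z).inter (ih z)
  have (ω : (Zd d → ℝ≥0) × (Sym2 (Zd d) → Bool)) : (openGraph ω).Reachable x y ↔
      ∃ n, ∃ p : (openGraph ω).Walk x y, p.length = n :=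
    ⟨fun ⟨p⟩ => ⟨_, p, rfl⟩, fun ⟨_, p, _⟩ => ⟨p⟩⟩
  simp only [this, Set.ofPred_exists (p := fun n ω => ∃ p : (openGraph ω).Walk x y, p.length = n)]
  exact .iUnion fun n => hwalk n x

lemma hasInfiniteCluster_iff {V : Type*} (G : SimpleGraph V) :
    HasInfiniteCluster G ↔ ∃ x, {y | G.Reachable x y}.Infinite := by
  have (x : V) : (G.connectedComponentMk x).supp = {y | G.Reachable x y} := by
    ext y
    simp only [SimpleGraph.ConnectedComponent.mem_supp_iff, SimpleGraph.ConnectedComponent.eq,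
      Set.mem_ofPred_eq]
    exact ⟨SimpleGraph.Reachable.symm, SimpleGraph.Reachable.symm⟩
  constructor
  · rintro ⟨C, hC⟩
    induction C using SimpleGraph.ConnectedComponent.ind with
    | h x => exact ⟨x, this x ▸ hC⟩
  · rintro ⟨x, hx⟩
    exact ⟨G.connectedComponentMk x, (this x).symm ▸ hx⟩

lemma HasInfiniteCluster.mono {V : Type*} {G H : SimpleGraph V} (h : G ≤ H)
    (hG : HasInfiniteCluster G) : HasInfiniteCluster H := by
  rw [hasInfiniteCluster_iff] at hG ⊢
  obtain ⟨x, hx⟩ := hG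
  exact ⟨x, hx.mono fun y hy => SimpleGraph.Reachable.mono h hy⟩

lemma measurableSet_hasInfiniteCluster (d : ℕ) :
    MeasurableSet {ω : (Zd d → ℝ≥0) × (Sym2 (Zd d) → Bool) |
      HasInfiniteCluster (openGraph ω)} := by
  have (ω : (Zd d → ℝ≥0) × (Sym2 (Zd d) → Bool)) : HasInfiniteCluster (openGraph ω) ↔
      ∃ x, ∀ F : Finset (Zd d), ∃ y, y ∉ F ∧ (openGraph ω).Reachable x y := by
    rw [hasInfiniteCluster_iff]
    refine exists_congr fun x => ⟨fun h F => ?_, fun h hfin => ?_⟩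
    · obtain ⟨y, hy, hyF⟩ := h.exists_notMem_finset F
      exact ⟨y, hyF, hy⟩
    · obtain ⟨y, hyF, hy⟩ := h hfin.toFinset
      exact hyF (by simpa using hy)
  simp only [this, Set.ofPred_exists, Set.ofPred_forall]
  exact .iUnion fun x => .iInter fun F => .iUnion fun y =>
    (MeasurableSet.const _).inter (measurableSet_reachable x y)

lemma ae_law_iff {d : ℕ} (α : ℝ) (lam : ℝ≥0) (μ : Measure ℝ≥0) [IsProbabilityMeasure μ]
    {S : Set ((Zd d → ℝ≥0) × (Sym2 (Zd d) → Bool))} (hS : MeasurableSet S) :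
    (∀ᵐ ω ∂(law d α lam μ), ω ∈ S) ↔
      ∀ᵐ w ∂(Measure.infinitePi fun _ : Zd d => μ), ∀ᵐ η ∂(edgeMeasure α lam w), (w, η) ∈ S :=
  Measure.ae_compProd_iff hS

/-- The infimum supplies some `lam' < lam` with an almost sure infinite cluster. The weight law does
not depend on `lam`, so it suffices to compare edge measures for fixed weights, where the event is
increasing. -/
theorem ae_hasInfiniteCluster {d : ℕ} {α : ℝ} {lam : ℝ≥0} {μ : Measure ℝ≥0}
    [IsProbabilityMeasure μ] (hlam : lambdaC d α μ < lam) :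
    ∀ᵐ ω ∂(law d α lam μ), HasInfiniteCluster (openGraph ω) := by
  obtain ⟨_, ⟨lam', rfl, -, h⟩, hlt⟩ := sInf_lt_iff.1 hlam
  have hle : lam' ≤ lam := by exact_mod_cast hlt.le
  have hS := measurableSet_hasInfiniteCluster d
  refine (ae_law_iff α lam μ hS).2 ?_
  filter_upwards [(ae_law_iff α lam' μ hS).1 h] with w hw
  refine ae_infinitePi_bernoulliMeasure_mono (fun e => edgeProb_mono α hle w e)
    (hS.preimage (measurable_const.prodMk measurable_id)) (fun η ξ hle hη => ?_) hw
  refine HasInfiniteCluster.mono (fun x y hxy => ?_) hη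
  rw [openGraph_adj] at hxy ⊢
  exact ⟨hle _ hxy.1, hxy.2⟩

end Coupling

/-! ### Moments of the weights and averaged connection probabilities. -/

section EdgeProbability

lemma one_sub_exp_neg_le_rpow {t s : ℝ} (ht : 0 ≤ t) (hs0 : 0 < s) (hs1 : s ≤ 1) :
    1 - Real.exp (-t) ≤ t ^ s := by
  rcases le_total t 1 with h | h
  · have h1 : 1 - Real.exp (-t) ≤ t := by linarith [Real.one_sub_le_exp_neg t]
    refine h1.trans ?_
    nth_rw 1 [← Real.rpow_one t]
    exact Real.rpow_le_rpow_of_exponent_ge_of_imp ht h hs1 fun _ h0 => absurd h0 one_ne_zero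
  · linarith [Real.exp_pos (-t), Real.one_le_rpow h hs0.le]

/-- A polynomial tail of order `τ - 1` gives finite moments of every smaller order. -/
lemma lintegral_rpow_lt_top {μ : Measure ℝ≥0} [IsProbabilityMeasure μ] {τ c s : ℝ}
    (htail : ∀ w : ℝ≥0, 0 < w → μ.real {v | w ≤ v} ≤ c * (w : ℝ) ^ (-(τ - 1)))
    (hs0 : 0 < s) (hs : s < τ - 1) : ∫⁻ w, ENNReal.ofReal ((w : ℝ) ^ s) ∂μ < ∞ := by
  rw [lintegral_rpow_eq_lintegral_meas_le_mul μ (f := fun w : ℝ≥0 => (w : ℝ))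
    (ae_of_all _ fun w => w.2) (by fun_prop) hs0]
  refine ENNReal.mul_lt_top ENNReal.ofReal_lt_top ?_
  -- In the layer-cake integral the tail is bounded by 1 on `(0, 1]`, where `s > 0` gives
  -- integrability, and by the power law on `(1, ∞)`, where `s < τ - 1` does.
  rw [← Set.Ioc_union_Ioi_eq_Ioi (zero_le_one (α := ℝ)),
    lintegral_union measurableSet_Ioi (Set.Ioc_disjoint_Ioi le_rfl)]
  refine ENNReal.add_lt_top.2 ⟨?_, ?_⟩
  · have hint : IntegrableOn (fun t : ℝ => t ^ (s - 1)) (Set.Ioc 0 1) :=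
      (intervalIntegrable_iff_integrableOn_Ioc_of_le zero_le_one).1
        (intervalIntegral.intervalIntegrable_rpow' (by linarith))
    refine lt_of_le_of_lt (lintegral_mono fun t => ?_) hint.lintegral_lt_top
    exact (mul_le_mul_left (prob_le_one (μ := μ)) _).trans (one_mul _).le
  · have hint : IntegrableOn (fun t : ℝ => c * t ^ (s - 1 - (τ - 1))) (Set.Ioi 1) :=
      (integrableOn_Ioi_rpow_of_lt (by linarith) zero_lt_one).const_mul c
    refine lt_of_le_of_lt (setLIntegral_mono' measurableSet_Ioi fun t ht => ?_)
      hint.lintegral_lt_top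
    have ht0 : 0 < t := zero_lt_one.trans ht
    have h1 := htail ⟨t, ht0.le⟩ ht0
    have h2 : μ {a : ℝ≥0 | t ≤ (a : ℝ)} = ENNReal.ofReal (μ.real {v | (⟨t, ht0.le⟩ : ℝ≥0) ≤ v}) := by
      rw [ofReal_measureReal]
      rfl
    rw [h2, ← ENNReal.ofReal_mul measureReal_nonneg]
    refine ENNReal.ofReal_le_ofReal ?_
    rw [sub_eq_add_neg (s - 1), Real.rpow_add ht0, mul_comm (t ^ (s - 1)), ← mul_assoc]
    exact mul_le_mul_of_nonneg_right h1 (Real.rpow_nonneg ht0.le _)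

lemma edgeMeasure_open {d : ℕ} (α : ℝ) (lam : ℝ≥0) (w : Zd d → ℝ≥0) (e : Sym2 (Zd d)) :
    edgeMeasure α lam w {η | η e = true} = ENNReal.ofReal (edgeProb α lam w e : ℝ) := by
  have hm : MeasurableSet ({true} : Set Bool) := measurableSet_singleton _
  have := Measure.infinitePi_map_eval (fun e => bernoulliMeasure true false (edgeProb α lam w e)) e
  have h2 : edgeMeasure α lam w {η | η e = true} =
      bernoulliMeasure true false (edgeProb α lam w e) {true} := by
    rw [← this, Measure.map_apply (measurable_pi_apply e) hm]
    rfl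
  rw [h2, bernoulliMeasure_apply _ hm]
  simp [unitInterval.toNNReal, ENNReal.ofReal, Real.toNNReal_of_nonneg (edgeProb α lam w e).2.1]
  rfl

/-- Bounding `1 - exp (-t)` by `t ^ s` makes the weights factor, so independence at `x ≠ y` leaves
the square of one moment. A smaller `s` weakens the moment required at the cost of slower decay in
the distance. -/
lemma law_adj_le {d : ℕ} (α : ℝ) (lam : ℝ≥0) (μ : Measure ℝ≥0) [IsProbabilityMeasure μ] {s : ℝ}
    (hs0 : 0 < s) (hs1 : s ≤ 1) {x y : Zd d} (hxy : x ≠ y) :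
    law d α lam μ {ω | (openGraph ω).Adj x y} ≤
      ENNReal.ofReal ((lam : ℝ) ^ s * dist1 x y ^ (-(α * s))) *
        (∫⁻ w, ENNReal.ofReal ((w : ℝ) ^ s) ∂μ) ^ 2 := by
  set φ : ℝ≥0 → ℝ≥0∞ := fun w => ENNReal.ofReal ((w : ℝ) ^ s)
  have hφm : Measurable φ := by fun_prop
  set π := Measure.infinitePi fun _ : Zd d => μ with hπ
  rw [law, Measure.compProd_apply (measurableSet_adj x y)]
  have hpt (w : Zd d → ℝ≥0) : edgeKernel d α lam w
      (Prod.mk w ⁻¹' {ω | (openGraph ω).Adj x y}) ≤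
        ENNReal.ofReal ((lam : ℝ) ^ s * dist1 x y ^ (-(α * s))) * (φ (w x) * φ (w y)) := by
    have hset : Prod.mk w ⁻¹' {ω | (openGraph ω).Adj x y} = {η | η s(x, y) = true} := by
      ext η
      simp [openGraph_adj, hxy]
    rw [hset]
    simp only [φ]
    rw [← ENNReal.ofReal_mul (Real.rpow_nonneg (w x).coe_nonneg s),
      ← ENNReal.ofReal_mul (mul_nonneg (Real.rpow_nonneg lam.coe_nonneg s)
        (Real.rpow_nonneg (dist1_nonneg x y) _))]
    refine (edgeMeasure_open α lam w s(x, y)).trans_le (ENNReal.ofReal_le_ofReal ?_)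
    have hr := dist1_nonneg x y
    have hrα := Real.rpow_nonneg hr α
    have ht : 0 ≤ (lam : ℝ) * ((w x : ℝ) * (w y : ℝ) / dist1 x y ^ α) :=
      mul_nonneg lam.coe_nonneg (div_nonneg (mul_nonneg (w x).coe_nonneg (w y).coe_nonneg) hrα)
    refine (one_sub_exp_neg_le_rpow ht hs0 hs1).trans_eq ?_
    rw [Real.mul_rpow lam.coe_nonneg (div_nonneg (mul_nonneg (w x).coe_nonneg (w y).coe_nonneg) hrα),
      Real.div_rpow (mul_nonneg (w x).coe_nonneg (w y).coe_nonneg) hrα, Real.mul_rpow (w x).coe_nonneg (w y).coe_nonneg,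
      ← Real.rpow_mul hr, Real.rpow_neg hr]
    ring
  have hind : IndepFun (fun w : Zd d → ℝ≥0 => φ (w x)) (fun w => φ (w y)) π :=
    (iIndepFun_infinitePi (P := fun _ : Zd d => μ) (X := fun _ => φ) fun _ => hφm).indepFun hxy
  have heval (z : Zd d) : ∫⁻ w, φ (w z) ∂π = ∫⁻ v, φ v ∂μ := by
    rw [← (measurePreserving_eval_infinitePi (fun _ : Zd d => μ) z).lintegral_comp hφm]
  have hmx (z : Zd d) : Measurable fun w : Zd d → ℝ≥0 => φ (w z) :=
    hφm.comp (measurable_pi_apply z)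
  have hmxy : Measurable fun w : Zd d → ℝ≥0 => φ (w x) * φ (w y) := (hmx x).mul (hmx y)
  refine (lintegral_mono hpt).trans_eq ?_
  rw [lintegral_const_mul _ hmxy]
  congr 1
  rw [sq, ← heval x]
  nth_rw 2 [heval x]
  rw [← heval y]
  exact lintegral_mul_eq_lintegral_mul_lintegral_of_indepFun (hmx x) (hmx y) hind

end EdgeProbability

/-! ### Lattice sums and the logarithmic cutoff on `ℤ²`. -/

section Lattice

/-- The supremum norm on `ℤ²`, as a natural number. -/
def supNorm (z : Zd 2) : ℕ := max (z 0).natAbs (z 1).natAbs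

lemma supNorm_le_dist1 (x y : Zd 2) : (supNorm (x - y) : ℝ) ≤ dist1 x y := by
  have h (i : Fin 2) : (((x - y) i).natAbs : ℝ) = |(x i : ℝ) - (y i : ℝ)| := by
    rw [Nat.cast_natAbs]
    simp
  rw [dist1, Fin.sum_univ_two, supNorm, Nat.cast_max, h, h]
  exact max_le (le_add_of_nonneg_right (abs_nonneg _)) (le_add_of_nonneg_left (abs_nonneg _))

lemma supNorm_eq_zero {z : Zd 2} : supNorm z = 0 ↔ z = 0 := by
  rw [funext_iff, Fin.forall_fin_two, supNorm]
  simp only [Pi.zero_apply]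
  omega

lemma supNorm_sub_comm (x y : Zd 2) : supNorm (x - y) = supNorm (y - x) := by
  simp only [supNorm, Pi.sub_apply]
  omega

lemma supNorm_sub_le (o x y : Zd 2) : supNorm (y - o) ≤ supNorm (x - o) + supNorm (x - y) := by
  simp only [supNorm, Pi.sub_apply]
  omega

/-- The sphere of radius `n` has `8 n` points if `n ≥ 1` and one if `n = 0`; `8 n + 1` covers both
cases. -/
lemma tsum_supNorm_le (g : ℕ → ℝ≥0∞) :
    ∑' z : Zd 2, g (supNorm z) ≤ ∑' n : ℕ, (8 * n + 1 : ℕ) * g n := by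
  have h1 : ∑' z : Zd 2, g (supNorm z) = ∑' p : ℤ × ℤ, g (max p.1.natAbs p.2.natAbs) :=
    (finTwoArrowEquiv ℤ).tsum_eq fun p : ℤ × ℤ => g (max p.1.natAbs p.2.natAbs)
  rw [h1, ← ENNReal.tsum_fiberwise _ fun p : ℤ × ℤ => max p.1.natAbs p.2.natAbs]
  refine ENNReal.tsum_le_tsum fun n => ?_
  have h2 : (fun p : ℤ × ℤ => max p.1.natAbs p.2.natAbs) ⁻¹' {n} =
      ((Finset.box n : Finset (ℤ × ℤ)) : Set (ℤ × ℤ)) := by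
    ext p; simp
  rw [h2, Finset.tsum_subtype' (Finset.box n) fun p : ℤ × ℤ => g (max p.1.natAbs p.2.natAbs),
    Finset.sum_congr rfl fun p hp => by rw [Int.mem_box.1 hp], Finset.sum_const, nsmul_eq_mul]
  gcongr
  rcases eq_or_ne n 0 with rfl | hn
  · simp
  · rw [Int.card_box hn]; omega

lemma tsum_supNorm_rpow_lt_top {β : ℝ} (hβ : 4 < β) :
    ∑' z : Zd 2, ENNReal.ofReal ((supNorm z : ℝ) ^ (-β)) * ENNReal.ofReal ((supNorm z : ℝ) ^ 2) <
      ∞ := by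
  refine (tsum_supNorm_le fun n => ENNReal.ofReal ((n : ℝ) ^ (-β)) *
    ENNReal.ofReal ((n : ℝ) ^ 2)).trans_lt ?_
  have hsum : Summable fun n : ℕ => 9 * (n : ℝ) ^ (3 - β) :=
    (Real.summable_nat_rpow.2 (by linarith)).mul_left 9
  refine lt_of_le_of_lt (ENNReal.tsum_le_tsum fun n => ?_) hsum.tsum_ofReal_lt_top
  rcases Nat.eq_zero_or_pos n with rfl | hn
  · simp
  have hn1 : (1 : ℝ) ≤ n := by exact_mod_cast hn
  have hn0 : (0 : ℝ) < n := zero_lt_one.trans_le hn1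
  have hp := Real.rpow_nonneg hn0.le (-β)
  rw [← ENNReal.ofReal_natCast, ← ENNReal.ofReal_mul hp,
    ← ENNReal.ofReal_mul (Nat.cast_nonneg _)]
  refine ENNReal.ofReal_le_ofReal ?_
  rw [sub_eq_add_neg, Real.rpow_add hn0, show (3 : ℝ) = ((3 : ℕ) : ℝ) by norm_num,
    Real.rpow_natCast]
  push_cast
  calc (8 * (n : ℝ) + 1) * ((n : ℝ) ^ (-β) * (n : ℝ) ^ 2)
      ≤ (9 * n) * ((n : ℝ) ^ (-β) * (n : ℝ) ^ 2) := by
        apply mul_le_mul_of_nonneg_right _ (by positivity)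
        linarith
    _ = _ := by ring

/-- The harmonic sum `1 + 1/2 + ⋯ + 1/n`. -/
noncomputable def harmonicSum (n : ℕ) : ℝ := ∑ k ∈ Finset.range n, 1 / ((k : ℝ) + 1)

lemma harmonicSum_mono : Monotone harmonicSum := fun m n hmn =>
  Finset.sum_le_sum_of_subset_of_nonneg (Finset.range_mono hmn) fun _ _ _ => by positivity

lemma harmonicSum_sub_le {a b : ℕ} (hab : a ≤ b) :
    harmonicSum b - harmonicSum a ≤ ((b : ℝ) - a) / (a + 1) := by
  induction b, hab using Nat.le_induction with
  | base => simp
  | succ b hab ih =>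
    have hab' : (a : ℝ) ≤ b := by exact_mod_cast hab
    have h1 : 1 / ((b : ℝ) + 1) ≤ 1 / (a + 1) :=
      one_div_le_one_div_of_le (by positivity) (by linarith)
    have h2 : harmonicSum (b + 1) = harmonicSum b + 1 / ((b : ℝ) + 1) := Finset.sum_range_succ _ _
    have h3 : ((b + 1 : ℕ) - (a : ℝ)) / (a + 1) = ((b : ℝ) - a) / (a + 1) + 1 / (a + 1) := by
      push_cast; ring
    linarith

lemma harmonicSum_pos {n : ℕ} (hn : 0 < n) : 0 < harmonicSum n :=
  Finset.sum_pos (fun _ _ => by positivity) ⟨0, by simpa using hn⟩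

lemma tendsto_harmonicSum : Tendsto harmonicSum atTop atTop :=
  Real.tendsto_sum_range_one_div_nat_succ_atTop

/-- The squared gradient `1 / (n + 1)²` of the harmonic sum, cut off at `N`. -/
noncomputable def gradSq (N n : ℕ) : ℝ := if n < N then 1 / ((n : ℝ) + 1) ^ 2 else 0

lemma gradSq_nonneg (N n : ℕ) : 0 ≤ gradSq N n := by
  unfold gradSq; split_ifs <;> positivity

/-- Increments of the harmonic sum decrease, so the slope at the smaller argument dominates. Keeping
both slopes makes the bound symmetric, so that it can be summed over either endpoint of an edge. -/
lemma harmonicSum_sub_sq_le (N a b : ℕ) :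
    (harmonicSum (min a N) - harmonicSum (min b N)) ^ 2 ≤
      ((a : ℝ) - b) ^ 2 * (gradSq N a + gradSq N b) := by
  wlog hab : a ≤ b generalizing a b
  · have := this b a (le_of_not_ge hab)
    linarith
  by_cases haN : a < N
  · have h0 : 0 ≤ harmonicSum (min b N) - harmonicSum (min a N) :=
      sub_nonneg.2 (harmonicSum_mono (min_le_min_right N hab))
    have h1 : harmonicSum (min b N) - harmonicSum (min a N) ≤ ((b : ℝ) - a) / (a + 1) := by
      rw [min_eq_left haN.le]
      have := harmonicSum_mono (min_le_left b N)
      linarith [harmonicSum_sub_le hab]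
    have h2 := pow_le_pow_left₀ h0 h1 2
    have h3 : (((b : ℝ) - a) / (a + 1)) ^ 2 = ((a : ℝ) - b) ^ 2 * gradSq N a := by
      rw [gradSq, if_pos haN, div_pow]
      ring
    have h4 : 0 ≤ ((a : ℝ) - b) ^ 2 * gradSq N b := mul_nonneg (sq_nonneg _) (gradSq_nonneg N b)
    nlinarith
  · rw [min_eq_right (not_lt.1 haN), min_eq_right ((not_lt.1 haN).trans hab), sub_self]
    have := mul_nonneg (sq_nonneg ((a : ℝ) - b)) (add_nonneg (gradSq_nonneg N a) (gradSq_nonneg N b))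
    simpa using this

/-- This is where dimension two enters: spheres of size about `8 n` against a squared gradient of
about `n ^ (-2)` give only logarithmic growth, because `(8 n + 1) / (n + 1) ^ 2 ≤ 8 / (n + 1)`. -/
lemma tsum_gradSq_supNorm_le (N : ℕ) :
    ∑' z : Zd 2, ENNReal.ofReal (gradSq N (supNorm z)) ≤ ENNReal.ofReal (8 * harmonicSum N) := by
  refine (tsum_supNorm_le fun n => ENNReal.ofReal (gradSq N n)).trans ?_
  rw [tsum_eq_sum (s := Finset.range N), harmonicSum, Finset.mul_sum,
    ENNReal.ofReal_sum_of_nonneg fun _ _ => by positivity]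
  · refine Finset.sum_le_sum fun n hn => ?_
    rw [← ENNReal.ofReal_natCast, ← ENNReal.ofReal_mul (Nat.cast_nonneg _)]
    refine ENNReal.ofReal_le_ofReal ?_
    rw [gradSq, if_pos (Finset.mem_range.1 hn), mul_one_div, mul_one_div,
      div_le_div_iff₀ (by positivity) (by positivity)]
    push_cast
    nlinarith [(Nat.cast_nonneg n : (0 : ℝ) ≤ n)]
  · intro n hn
    simp [gradSq, Finset.mem_range.not.1 hn]

/-- The logarithmic cutoff around `o` at scale `N`: it is `1` at `o` and vanishes at distance at
least `N`. -/
noncomputable def logCutoff (o : Zd 2) (N : ℕ) (x : Zd 2) : ℝ :=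
  1 - harmonicSum (min (supNorm (x - o)) N) / harmonicSum N

lemma logCutoff_self (o : Zd 2) (N : ℕ) : logCutoff o N o = 1 := by
  simp [logCutoff, supNorm, harmonicSum]

lemma logCutoff_support_finite (o : Zd 2) {N : ℕ} (hN : 0 < N) :
    (logCutoff o N).support.Finite := by
  refine (Set.finite_Icc (o - fun _ => (N : ℤ)) (o + fun _ => (N : ℤ))).subset fun x hx => ?_
  have hlt : supNorm (x - o) < N := by
    by_contra h
    refine hx ?_
    rw [logCutoff, min_eq_right (not_lt.1 h), div_self (harmonicSum_pos hN).ne', sub_self]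
  simp only [supNorm, Pi.sub_apply] at hlt
  constructor
  · intro i
    fin_cases i <;> simp <;> omega
  · intro i
    fin_cases i <;> simp <;> omega

lemma logCutoff_sub_sq_le (o : Zd 2) {N : ℕ} (hN : 0 < N) (x y : Zd 2) :
    (logCutoff o N x - logCutoff o N y) ^ 2 ≤ (harmonicSum N ^ 2)⁻¹ *
      ((supNorm (x - y) : ℝ) ^ 2 *
        (gradSq N (supNorm (x - o)) + gradSq N (supNorm (y - o)))) := by
  have hH := harmonicSum_pos hN
  have h1 : (logCutoff o N x - logCutoff o N y) ^ 2 = (harmonicSum N ^ 2)⁻¹ *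
      (harmonicSum (min (supNorm (x - o)) N) - harmonicSum (min (supNorm (y - o)) N)) ^ 2 := by
    simp only [logCutoff]
    field_simp
    ring
  rw [h1]
  refine mul_le_mul_of_nonneg_left ((harmonicSum_sub_sq_le _ _ _).trans ?_) (by positivity)
  refine mul_le_mul_of_nonneg_right ?_ (add_nonneg (gradSq_nonneg _ _) (gradSq_nonneg _ _))
  rw [sq_le_sq, Nat.abs_cast, abs_le]
  have h2 : (supNorm (y - o) : ℝ) ≤ supNorm (x - o) + supNorm (x - y) := by
    exact_mod_cast supNorm_sub_le o x y
  have h3 : (supNorm (x - o) : ℝ) ≤ supNorm (y - o) + supNorm (x - y) := by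
    rw [supNorm_sub_comm x y]
    exact_mod_cast supNorm_sub_le o y x
  constructor <;> linarith

/-- If the connection function `C` has a finite second moment, then the expected energy of the
logarithmic cutoff at scale `N` is of order `1 / log N`. -/
lemma tsum_mul_logCutoff_le (C : Zd 2 → ℝ≥0∞) (o : Zd 2) {N : ℕ} (hN : 0 < N)
    (hC : ∀ z, C (-z) = C z) :
    ∑' x, ∑' y, C (x - y) * ENNReal.ofReal ((logCutoff o N x - logCutoff o N y) ^ 2) ≤
      ENNReal.ofReal (16 / harmonicSum N) *
        ∑' z, C z * ENNReal.ofReal ((supNorm z : ℝ) ^ 2) := by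
  set H := harmonicSum N with hH
  have hHpos : 0 < H := harmonicSum_pos hN
  set M := ∑' z, C z * ENNReal.ofReal ((supNorm z : ℝ) ^ 2) with hM
  let k : Zd 2 → ℝ≥0∞ := fun z => C z * ENNReal.ofReal ((supNorm z : ℝ) ^ 2)
  let g : Zd 2 → ℝ≥0∞ := fun x => ENNReal.ofReal (gradSq N (supNorm (x - o)))
  have hk (x y : Zd 2) : k (x - y) = k (y - x) := by
    simp only [k]
    rw [supNorm_sub_comm, ← hC (x - y), neg_sub]
  have hpt (x y : Zd 2) : C (x - y) * ENNReal.ofReal ((logCutoff o N x - logCutoff o N y) ^ 2) ≤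
      ENNReal.ofReal (H ^ 2)⁻¹ * (k (x - y) * g x + k (x - y) * g y) := by
    refine (mul_le_mul_right (ENNReal.ofReal_le_ofReal (logCutoff_sub_sq_le o hN x y)) _).trans_eq ?_
    rw [ENNReal.ofReal_mul (by positivity), ENNReal.ofReal_mul (by positivity),
      ENNReal.ofReal_add (gradSq_nonneg _ _) (gradSq_nonneg _ _)]
    simp only [k, g]
    ring
  have hg : ∑' x, g x ≤ ENNReal.ofReal (8 * H) := by
    have : ∑' x, g x = ∑' z, ENNReal.ofReal (gradSq N (supNorm z)) :=
      (Equiv.subRight o).tsum_eq fun z => ENNReal.ofReal (gradSq N (supNorm z))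
    rw [this]
    exact tsum_gradSq_supNorm_le N
  have hshift (x : Zd 2) : ∑' y, k (x - y) = M := (Equiv.subLeft x).tsum_eq k
  have hfirst : ∑' x, ∑' y, k (x - y) * g x = M * ∑' x, g x := by
    simp only [ENNReal.tsum_mul_right, hshift, ENNReal.tsum_mul_left]
  have hsecond : ∑' x, ∑' y, k (x - y) * g y = M * ∑' x, g x := by
    rw [ENNReal.tsum_comm, ← hfirst]
    simp only [hk]
  calc ∑' x, ∑' y, C (x - y) * ENNReal.ofReal ((logCutoff o N x - logCutoff o N y) ^ 2)
      ≤ ∑' x, ∑' y, ENNReal.ofReal (H ^ 2)⁻¹ * (k (x - y) * g x + k (x - y) * g y) :=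
        ENNReal.tsum_le_tsum fun x => ENNReal.tsum_le_tsum fun y => hpt x y
    _ = ENNReal.ofReal (H ^ 2)⁻¹ * (M * ∑' x, g x + M * ∑' x, g x) := by
        simp only [ENNReal.tsum_mul_left, ENNReal.tsum_add, hfirst, hsecond]
    _ ≤ ENNReal.ofReal (H ^ 2)⁻¹ * (M * ENNReal.ofReal (8 * H) + M * ENNReal.ofReal (8 * H)) := by
        gcongr
    _ = ENNReal.ofReal (16 / H) * M := by
        -- One `8 H` for each endpoint of the edge, divided by the normalisation `H ^ 2` of the
        -- cutoff.
        have : 16 / H = (H ^ 2)⁻¹ * (8 * H + 8 * H) := by field_simp; norm_num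
        rw [this, ENNReal.ofReal_mul (p := (H ^ 2)⁻¹) (by positivity),
          ENNReal.ofReal_add (by positivity) (by positivity)]
        ring

end Lattice

/-! ### Small energies almost surely, and recurrence of all clusters. -/

section Recurrence

open Classical in
/-- The Dirichlet energy of `f` on `G`, over ordered pairs of neighbours. -/
noncomputable def energy {V : Type*} (G : SimpleGraph V) (f : V → ℝ) : ℝ≥0∞ :=
  ∑' x, ∑' y, if G.Adj x y then ENNReal.ofReal ((f x - f y) ^ 2) else 0

lemma ofReal_dirichlet_le_energy {V : Type*} (G : SimpleGraph V) (S : Finset V) (f : V → ℝ) :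
    ENNReal.ofReal (dirichlet G S f f) ≤ energy G f := by
  classical
  have hnn (u v : V) : 0 ≤ if G.Adj u v then (f u - f v) * (f u - f v) else 0 := by
    split_ifs
    · exact mul_self_nonneg _
    · exact le_rfl
  rw [dirichlet, ENNReal.ofReal_sum_of_nonneg fun u _ => Finset.sum_nonneg fun v _ => hnn u v]
  refine le_trans (Finset.sum_le_sum fun u _ => ?_) (ENNReal.sum_le_tsum S)
  rw [ENNReal.ofReal_sum_of_nonneg fun v _ => hnn u v]
  refine le_trans (Finset.sum_le_sum fun v _ => ?_) (ENNReal.sum_le_tsum S)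
  split_ifs <;> simp [sq]

lemma energy_induce_le {V : Type*} (G : SimpleGraph V) (s : Set V) (f : V → ℝ) :
    energy (G.induce s) (fun v => f v) ≤ energy G f := by
  classical
  refine le_trans (ENNReal.tsum_le_tsum fun x : s => ?_)
    (ENNReal.tsum_comp_le_tsum_of_injective Subtype.val_injective
      fun x => ∑' y, if G.Adj x y then ENNReal.ofReal ((f x - f y) ^ 2) else 0)
  exact ENNReal.tsum_comp_le_tsum_of_injective (f := ((↑) : s → V)) Subtype.val_injective
    fun y => if G.Adj x y then ENNReal.ofReal ((f x - f y) ^ 2) else 0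

/-- Every component of a locally finite graph that carries, around each vertex, unit potentials of
finite support and arbitrarily small energy, is recurrent. -/
theorem isRecurrent_toSimpleGraph {V : Type*} [Countable V] [MeasurableSpace V]
    [MeasurableSingletonClass V]
    (G : SimpleGraph V) (hG : ∀ v, (G.neighborSet v).Finite)
    (hE : ∀ x, ∀ ε : ℝ≥0∞, 0 < ε → ∃ f : V → ℝ, f.support.Finite ∧ f x = 1 ∧ energy G f ≤ ε)
    (C : G.ConnectedComponent) : IsRecurrent C.toSimpleGraph := by
  have hfin (v : C) : (C.toSimpleGraph.neighborSet v).Finite :=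
    Set.Finite.of_finite_image ((hG v).subset (by rintro _ ⟨u, hu, rfl⟩; exact hu))
      Subtype.val_injective.injOn
  refine ⟨hfin, fun x => ae_return_of_dirichlet_le _ hfin x fun ε hε => ?_⟩
  obtain ⟨f, hf, hfx, hfE⟩ := hE x (ENNReal.ofReal ε) (by simpa using hε)
  refine ⟨fun v => f v, hf.preimage Subtype.val_injective.injOn, hfx, fun S => ?_⟩
  have := (ofReal_dirichlet_le_energy C.toSimpleGraph S fun v => f v).trans
    ((energy_induce_le G C.supp f).trans hfE)
  rwa [ENNReal.ofReal_le_ofReal_iff hε.le] at this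

variable {Ω : Type*} [MeasurableSpace Ω]

/-- Borel–Cantelli at each vertex: the edge probabilities there are summable. -/
lemma ae_locallyFinite (P : Measure Ω) (G : Ω → SimpleGraph (Zd 2)) (C : Zd 2 → ℝ≥0∞)
    (hP : ∀ x y, P {ω | (G ω).Adj x y} ≤ C (x - y)) (hC : ∑' z, C z ≠ ∞) :
    ∀ᵐ ω ∂P, ∀ x, ((G ω).neighborSet x).Finite := by
  refine ae_all_iff.2 fun x => ?_
  have : ∑' y, P {ω | (G ω).Adj x y} ≠ ∞ := by
    refine ne_top_of_le_ne_top hC ((ENNReal.tsum_le_tsum fun y => hP x y).trans ?_)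
    exact ((Equiv.subLeft x).tsum_eq C).le
  exact ae_finite_setOfPred_mem this

lemma ae_exists_energy_le (P : Measure Ω) (G : Ω → SimpleGraph (Zd 2))
    (hG : ∀ x y, MeasurableSet {ω | (G ω).Adj x y}) (C : Zd 2 → ℝ≥0∞)
    (hP : ∀ x y, P {ω | (G ω).Adj x y} ≤ C (x - y)) (hCneg : ∀ z, C (-z) = C z)
    (hC : ∑' z, C z * ENNReal.ofReal ((supNorm z : ℝ) ^ 2) ≠ ∞) (o : Zd 2) :
    ∀ᵐ ω ∂P, ∀ ε : ℝ≥0∞, 0 < ε →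
      ∃ f : Zd 2 → ℝ, f.support.Finite ∧ f o = 1 ∧ energy (G ω) f ≤ ε := by
  classical
  set M := ∑' z, C z * ENNReal.ofReal ((supNorm z : ℝ) ^ 2) with hM
  let E : ℕ → Ω → ℝ≥0∞ := fun n ω => energy (G ω) (logCutoff o (n + 1))
  have hterm (n : ℕ) (x y : Zd 2) : Measurable fun ω => if (G ω).Adj x y then
      ENNReal.ofReal ((logCutoff o (n + 1) x - logCutoff o (n + 1) y) ^ 2) else 0 :=
    Measurable.ite (hG x y) measurable_const measurable_const
  have hEm (n : ℕ) : Measurable (E n) :=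
    Measurable.tsum fun x => Measurable.tsum fun y => hterm n x y
  have hint (n : ℕ) : ∫⁻ ω, E n ω ∂P ≤ ENNReal.ofReal (16 / harmonicSum (n + 1)) * M := by
    refine le_trans (le_of_eq ?_) ((ENNReal.tsum_le_tsum fun x => ENNReal.tsum_le_tsum fun y =>
      mul_le_mul_left (hP x y) _).trans (tsum_mul_logCutoff_le C o n.succ_pos hCneg))
    simp only [E, energy]
    rw [lintegral_tsum fun x => (Measurable.tsum fun y => hterm n x y).aemeasurable]
    refine tsum_congr fun x => ?_
    rw [lintegral_tsum fun y => (hterm n x y).aemeasurable]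
    refine tsum_congr fun y => ?_
    have : (fun ω => if (G ω).Adj x y then
        ENNReal.ofReal ((logCutoff o (n + 1) x - logCutoff o (n + 1) y) ^ 2) else 0) =
        {ω | (G ω).Adj x y}.indicator fun _ =>
          ENNReal.ofReal ((logCutoff o (n + 1) x - logCutoff o (n + 1) y) ^ 2) := by
      ext ω
      simp [Set.indicator_apply]
    rw [this, lintegral_indicator_const (hG x y), mul_comm]
  have hlim : Tendsto (fun n => ENNReal.ofReal (16 / harmonicSum (n + 1)) * M) atTop (𝓝 0) := by
    have h1 : Tendsto (fun n => 16 / harmonicSum (n + 1)) atTop (𝓝 0) :=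
      (tendsto_harmonicSum.comp (tendsto_add_atTop_nat 1)).const_div_atTop 16
    simpa using ENNReal.Tendsto.mul_const (ENNReal.tendsto_ofReal h1) (Or.inr hC)
  -- Fatou: expected energies tending to 0 make the liminf of the energies vanish almost surely, so
  -- no rate or subsequence is needed. A single null set serves all `ε`.
  have hzero : ∫⁻ ω, liminf (fun n => E n ω) atTop ∂P = 0 := by
    refine le_antisymm ?_ bot_le
    refine (lintegral_liminf_le hEm).trans ?_
    rw [← (tendsto_of_tendsto_of_tendsto_of_le_of_le tendsto_const_nhds hlim
      (fun _ => bot_le) hint).liminf_eq]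
  rw [lintegral_eq_zero_iff (Measurable.liminf hEm)] at hzero
  filter_upwards [hzero] with ω hω ε hε
  have hlt : liminf (fun n => E n ω) atTop < ε := by
    rw [show liminf (fun n => E n ω) atTop = 0 from hω]
    exact hε
  obtain ⟨n, hn⟩ := (frequently_lt_of_liminf_lt (by isBoundedDefault) hlt).exists
  exact ⟨_, logCutoff_support_finite o n.succ_pos, logCutoff_self o _, hn.le⟩

/-- A random graph on `ℤ²` whose connection probabilities have a finite second moment has only
recurrent components. -/
theorem ae_isRecurrent_of_moment (P : Measure Ω) (G : Ω → SimpleGraph (Zd 2))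
    (hG : ∀ x y, MeasurableSet {ω | (G ω).Adj x y}) (C : Zd 2 → ℝ≥0∞)
    (hP : ∀ x y, P {ω | (G ω).Adj x y} ≤ C (x - y)) (hCneg : ∀ z, C (-z) = C z)
    (hC0 : C 0 ≠ ∞) (hC : ∑' z, C z * ENNReal.ofReal ((supNorm z : ℝ) ^ 2) ≠ ∞) :
    ∀ᵐ ω ∂P, ∀ K : (G ω).ConnectedComponent, IsRecurrent K.toSimpleGraph := by
  classical
  have hsum : ∑' z, C z ≠ ∞ := by
    -- The second moment does not see `z = 0`, so that term is added by hand; elsewhere `supNorm z ≥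
    -- 1`.
    have h1 : ∑' z, (if z = (0 : Zd 2) then C 0 else 0) ≠ ∞ := by rwa [tsum_ite_eq]
    refine ne_top_of_le_ne_top (ENNReal.add_ne_top.2 ⟨h1, hC⟩) ?_
    rw [← ENNReal.tsum_add]
    refine ENNReal.tsum_le_tsum fun z => ?_
    by_cases hz : z = 0
    · simp [hz]
    · have h2 : (1 : ℝ) ≤ supNorm z := by
        exact_mod_cast Nat.one_le_iff_ne_zero.2 (supNorm_eq_zero.not.2 hz)
      rw [if_neg hz, zero_add]
      refine le_mul_of_one_le_right bot_le ?_
      rw [ENNReal.one_le_ofReal]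
      exact one_le_pow₀ h2
  filter_upwards [ae_locallyFinite P G C hP hsum,
    ae_all_iff.2 fun o => ae_exists_energy_le P G hG C hP hCneg hC o] with ω h1 h2 K
  exact isRecurrent_toSimpleGraph (G ω) h1 h2 K

theorem ae_isRecurrent {α τ c : ℝ} {lam : ℝ≥0} {μ : Measure ℝ≥0} [IsProbabilityMeasure μ]
    (htail : ∀ w : ℝ≥0, 0 < w → μ.real {v | w ≤ v} ≤ c * (w : ℝ) ^ (-(τ - 1)))
    (hα : 4 < α) (hτγ : 2 < τ ∨ 2 < gammaParam 2 α τ) :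
    ∀ᵐ ω ∂(law 2 α lam μ), ∀ K : (openGraph ω).ConnectedComponent,
      IsRecurrent K.toSimpleGraph := by
  have hα0 : 0 < α := by linarith
  -- `s > 4 / α` gives a finite second moment of the connection function in dimension two, `s ≤ 1`
  -- the edge bound, and `s < τ - 1` the weight moment. If `τ > 2` the minimum is 1 and `α > 4`
  -- suffices; `γ > 2` says exactly `4 / α < τ - 1`.
  have hlt : 4 / α < min 1 (τ - 1) := by
    refine lt_min ((div_lt_one hα0).2 hα) ((div_lt_iff₀ hα0).2 ?_)
    rcases hτγ with h | h
    · nlinarith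
    · rw [gammaParam] at h
      push_cast at h
      linarith
  obtain ⟨s, hs4, hs⟩ := exists_between hlt
  have hs0 : 0 < s := (div_pos four_pos hα0).trans hs4
  have hβ : 4 < α * s := by rwa [div_lt_iff₀' hα0] at hs4
  set I := ∫⁻ w, ENNReal.ofReal ((w : ℝ) ^ s) ∂μ with hI
  have hIfin : I < ∞ := lintegral_rpow_lt_top htail hs0 (hs.trans_le (min_le_right _ _))
  set A : ℝ≥0∞ := ENNReal.ofReal ((lam : ℝ) ^ s) * I ^ 2 with hA
  have hAfin : A ≠ ∞ := ENNReal.mul_ne_top ENNReal.ofReal_ne_top (ENNReal.pow_ne_top hIfin.ne)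
  refine ae_isRecurrent_of_moment _ _ measurableSet_adj
    (fun z => A * ENNReal.ofReal ((supNorm z : ℝ) ^ (-(α * s)))) (fun x y => ?_) (fun z => ?_)
    (ENNReal.mul_ne_top hAfin ENNReal.ofReal_ne_top) ?_
  · by_cases hxy : x = y
    · simp [hxy]
    · refine (law_adj_le α lam μ hs0 (hs.le.trans (min_le_left _ _)) hxy).trans ?_
      rw [ENNReal.ofReal_mul (Real.rpow_nonneg lam.coe_nonneg s), mul_right_comm]
      have hpos : (0 : ℝ) < supNorm (x - y) := by
        exact_mod_cast Nat.pos_of_ne_zero (supNorm_eq_zero.not.2 (sub_ne_zero.2 hxy))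
      refine mul_le_mul_right (ENNReal.ofReal_le_ofReal ?_) _
      -- The exponent is negative, so passing from the `ℓ¹`-distance to the smaller supremum norm
      -- enlarges the bound.
      exact Real.rpow_le_rpow_of_nonpos hpos (supNorm_le_dist1 x y) (by linarith)
  · rw [← zero_sub, supNorm_sub_comm, sub_zero]
  · simp only [mul_assoc, ENNReal.tsum_mul_left]
    exact ENNReal.mul_ne_top hAfin (tsum_supNorm_rpow_lt_top hβ).ne

end Recurrence

end SFP

theorem theorem2p3
    (α τ c : ℝ) (lam : ℝ≥0) (μ : Measure ℝ≥0) [IsProbabilityMeasure μ]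
    (hτ : 1 < τ) (hc : 0 < c)
    (htail : ∀ w : ℝ≥0, 0 < w → μ.real {v | w ≤ v} ≤ c * (w : ℝ) ^ (-(τ - 1)))
    (hα : 4 < α)
    (hlam : SFP.lambdaC 2 α μ < (lam : ℝ≥0∞))
    (hτγ : 2 < τ ∨ 2 < SFP.gammaParam 2 α τ) :
    ∀ᵐ ω ∂(SFP.law 2 α lam μ),
      SFP.HasInfiniteCluster (SFP.openGraph ω) ∧
      ∀ C : (SFP.openGraph ω).ConnectedComponent, C.supp.Infinite →
        SFP.IsRecurrent C.toSimpleGraph := by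
  filter_upwards [SFP.ae_hasInfiniteCluster hlam,
    SFP.ae_isRecurrent (lam := lam) htail hα hτγ] with ω h1 h2
  exact ⟨h1, fun C _ => h2 C⟩
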